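/- \textbf{Setting.} Let $A\in\mathbb{R}^{m\times n}$ have full row rank $m$. For $x,s\in\mathbb{R}^n$ with $x,s>0$ put $\mu=x^{T}s/n$, $X=\mathrm{diag}(x)$, $S=\mathrm{diag}(s)$, and $D=X^{1/2}S^{-1/2}$. For $\theta<1$ let $\mathcal{N}_2(\theta)$ be the set of $(x,y,s)\in\mathbb{R}^{n}\times\mathbb{R}^m\times\mathbb{R}^n$ with $x,s>0$ and $\|x\circ s-\mu\mathbf{1}_n\|_2\le\theta\mu$. For a centering parameter $\sigma\in[0,1]$ let $p=-\sigma\mu AS^{-1}\mathbf{1}_n+Ax$. Write $\|v\|_M=\sqrt{v^{T}Mv}$, let $\|\cdot\|_2$ be the Euclidean norm of vectors and the induced norm of matrices, and let $\log^+ r=\max\{0,\log r\}$. Let $AD=U\Sigma V$ be a thin SVD, with $U\in\mathbb{R}^{m\times m}$ orthogonal and $V\in\mathbb{R}^{m\times n}$ having orthonormal rows. Let $\zeta\in(0,1)$, let $\eta$ be a failure probability, and let $W\in\mathbb{R}^{n\times w}$ be a random (sketching) matrix such that $\|VWW^{T}V^{T}-I_m\|_2\le\zeta/2$ with probability at least $1-\eta$.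 \textbf{Algorithm (PCG).} Form $Q=ADWW^{T}DA^{T}$ and $Q^{-1/2}=U_Q\Sigma_Q^{-1/2}U_Q^{T}$, where the columns of $U_Q$ are the left singular vectors, and the diagonal entries of $\Sigma_Q^{1/2}$ the corresponding singular values, of $ADW$ (inverses of zero singular values being read as $0$). Run $t$ steps of the standard conjugate gradient method on $Q^{-1/2}AD^2A^{T}Q^{-1/2}\tilde z=Q^{-1/2}p$ from $\tilde z^{0}=0$, and return $\Delta\tilde y=Q^{-1/2}\tilde z^{t}$. \textbf{Lemma.} For all $\theta<1$ and $\zeta\in(0,1)$ there is a constant $C>0$, depending only on $\theta$ and $\zeta$, such that for all data as above with $(x,y,s)\in\mathcal{N}_2(\theta)$ and every $\delta>0$ the following holds. If $$t\;\ge\;C\Bigl(1+\log^+\frac{\max\{1,\sigma_{\max}(AD)\}\,\sqrt{n\mu}}{\delta}\Bigr),$$ or if $\sigma_{\max}(AD)\ge1$, $n\mu\ge1$ and $$t\;\ge\;C\Bigl(1+\log^+\frac{\sigma_{\max}(AD)\,n\mu}{\delta}\Bigr),$$ then, with probability at least $1-\eta$, the output $\Delta\tilde y$ of the algorithm satisfies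 $$\|\Delta\tilde y-(AD^2A^{T})^{-1}p\|_{AD^2A^{T}}\le\delta\qquad\text{and}\qquad\|AD^2A^{T}\Delta\tilde y-p\|_2\le\delta ,$$ that is, it meets the requirements on $\mathtt{Solve}(AD^2A^{T},p,\delta)$. In particular, $t=O\bigl(\log\frac{\sigma_{\max}(AD)\,n\mu}{\delta}\bigr)$ iterations suffice when $\sigma_{\max}(AD)\ge1$, $n\mu\ge1$, and this logarithm is bounded away from $0$. -/

import Mathlib

open MeasureTheory
open scoped Matrix

namespace SketchPCG

noncomputable section

/-! ### Norms and singular values -/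

/-- The Euclidean norm of a coordinate vector. -/
def norm2 {k : ℕ} (v : Fin k → ℝ) : ℝ := ‖(WithLp.toLp 2 v : EuclideanSpace ℝ (Fin k))‖

/-- The energy norm `√(vᵀ M v)`. -/
def energyNorm {k : ℕ} (M : Matrix (Fin k) (Fin k) ℝ) (v : Fin k → ℝ) : ℝ :=
  Real.sqrt (v ⬝ᵥ (M *ᵥ v))

open scoped Matrix.Norms.L2Operator in
/-- The spectral norm: the operator norm of a matrix induced by the Euclidean norms. -/
def specNorm {k l : ℕ} (M : Matrix (Fin k) (Fin l) ℝ) : ℝ := ‖M‖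

/-- The largest singular value (Mathlib lists singular values in decreasing order from index 0). -/
def sigmaMax {k l : ℕ} (M : Matrix (Fin k) (Fin l) ℝ) : ℝ :=
  (Matrix.toEuclideanLin M).singularValues 0

/-- A thin singular value decomposition `M = U Σ V` of a `k × l` matrix of full row rank:
`U` is orthogonal of size `k`, `Σ = diag d` has nonnegative decreasing diagonal, and
`V` is `k × l` with orthonormal rows (the right singular vectors are the rows of `V`). -/
structure IsThinSVD {k l : ℕ} (M : Matrix (Fin k) (Fin l) ℝ) (U : Matrix (Fin k) (Fin k) ℝ)
    (d : Fin k → ℝ) (V : Matrix (Fin k) (Fin l) ℝ) : Prop where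
  left_orthogonal : Uᵀ * U = 1
  right_orthonormal : V * Vᵀ = 1
  nonneg : ∀ i, 0 ≤ d i
  antitone : Antitone d
  eq : M = U * Matrix.diagonal d * V

/-! ### Interior point notions -/

/-- The duality measure `μ = xᵀ s / n`. -/
def dualityMeasure {n : ℕ} (x s : Fin n → ℝ) : ℝ := (x ⬝ᵥ s) / n

/-- The neighbourhood `𝒩₂(θ)` of triples `(x, y, s)` with `x, s > 0` and
`‖x ∘ s - μ 1‖₂ ≤ θ μ`. -/
def N2 (n m : ℕ) (θ : ℝ) : Set ((Fin n → ℝ) × (Fin m → ℝ) × (Fin n → ℝ)) :=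
  {z | norm2 (fun i => z.1 i * z.2.2 i - dualityMeasure z.1 z.2.2)
        ≤ θ * dualityMeasure z.1 z.2.2 ∧
      (∀ i, 0 < z.1 i) ∧ (∀ i, 0 < z.2.2 i)}

/-- The positive diagonal matrix `D` with `D² = X S⁻¹`. -/
def scaling {n : ℕ} (x s : Fin n → ℝ) : Matrix (Fin n) (Fin n) ℝ :=
  Matrix.diagonal fun i => Real.sqrt (x i / s i)

/-- The matrix `A D² Aᵀ` of the normal equations. -/
def normalMatrix {m n : ℕ} (A : Matrix (Fin m) (Fin n) ℝ) (x s : Fin n → ℝ) :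
    Matrix (Fin m) (Fin m) ℝ :=
  A * scaling x s ^ 2 * Aᵀ

/-- The right-hand side `p = -σ μ A S⁻¹ 1 + A x` of the normal equations, with centering
parameter `σ`. -/
def normalRhs {m n : ℕ} (A : Matrix (Fin m) (Fin n) ℝ) (x s : Fin n → ℝ) (σ : ℝ) : Fin m → ℝ :=
  -((σ * dualityMeasure x s) • (A *ᵥ fun i => (s i)⁻¹)) + A *ᵥ x

/-- The guarantee required of `Δy = Solve(K, p, δ)`: energy-norm error and residual 2-norm are
both at most `δ`. -/
def SolveGuarantee {m : ℕ} (K : Matrix (Fin m) (Fin m) ℝ) (p : Fin m → ℝ) (δ : ℝ)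
    (Δy : Fin m → ℝ) : Prop :=
  energyNorm K (Δy - K⁻¹ *ᵥ p) ≤ δ ∧ norm2 (K *ᵥ Δy - p) ≤ δ

/-! ### Conjugate gradients -/

/-- The state of the conjugate gradient iteration: iterate, residual, search direction. -/
structure CGState (k : ℕ) where
  z : Fin k → ℝ
  r : Fin k → ℝ
  d : Fin k → ℝ

/-- One step of standard (Hestenes-Stiefel) CG for `H z = b`. If the residual already vanishes,
the state is unchanged, since division by zero gives zero. -/
def cgStep {k : ℕ} (H : Matrix (Fin k) (Fin k) ℝ) (S : CGState k) : CGState k :=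
  let α : ℝ := (S.r ⬝ᵥ S.r) / (S.d ⬝ᵥ (H *ᵥ S.d))
  let r' : Fin k → ℝ := S.r - α • (H *ᵥ S.d)
  let β : ℝ := (r' ⬝ᵥ r') / (S.r ⬝ᵥ S.r)
  { z := S.z + α • S.d
    r := r'
    d := r' + β • S.d }

/-- The `t`-th iterate of CG for `H z = b` started at `z⁰ = 0`. -/
def cgIterate {k : ℕ} (H : Matrix (Fin k) (Fin k) ℝ) (b : Fin k → ℝ) (t : ℕ) : Fin k → ℝ :=
  ((cgStep H)^[t] { z := 0, r := b, d := b }).z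

/-! ### The sketched preconditioner and preconditioned CG -/

theorem isHermitian_gram {m w : ℕ} (M : Matrix (Fin m) (Fin w) ℝ) : (M * Mᵀ).IsHermitian := by
  simpa using Matrix.isHermitian_mul_conjTranspose_self M

/-- For `M = A D W`, so that `Q = M Mᵀ = A D W Wᵀ D Aᵀ`, the preconditioner
`Q^{-1/2} = U_Q Σ_Q^{-1/2} U_Qᵀ`. The columns of `U_Q` are the left singular vectors of `M`, i.e.
orthonormal eigenvectors of `M Mᵀ`, and the diagonal of `Σ_Q^{1/2}` consists of the singular
values of `M`, i.e. the square roots of the corresponding eigenvalues. -/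
def invSqrtGram {m w : ℕ} (M : Matrix (Fin m) (Fin w) ℝ) : Matrix (Fin m) (Fin m) ℝ :=
  let UQ : Matrix (Fin m) (Fin m) ℝ := (isHermitian_gram M).eigenvectorUnitary
  UQ * Matrix.diagonal (fun i => (Real.sqrt ((isHermitian_gram M).eigenvalues i))⁻¹) * UQᵀ

/-- Preconditioned conjugate gradients with input `B = A D`, right-hand side `p`, sketching matrix
`W` and iteration count `t`: run `t` steps of CG from `0` on
`Q^{-1/2} B Bᵀ Q^{-1/2} z = Q^{-1/2} p` and return `Q^{-1/2} zᵗ`. -/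
def pcg {m n w : ℕ} (B : Matrix (Fin m) (Fin n) ℝ) (p : Fin m → ℝ)
    (W : Matrix (Fin n) (Fin w) ℝ) (t : ℕ) : Fin m → ℝ :=
  let R := invSqrtGram (B * W)
  R *ᵥ cgIterate (R * (B * Bᵀ) * R) (R *ᵥ p) t

end

end SketchPCG

/-! Put `B = A D` and `K = B Bᵀ`. The sketching bound on the row space of `B` says that `Q = B W (B
W)ᵀ` lies between `(1 - ζ/2) K` and `(1 + ζ/2) K`, so `Q^{-1/2} K Q^{-1/2}` has condition number at
most `(1 + ζ/2) / (1 - ζ/2)`, a function of `ζ` alone. Since the constant may depend on `ζ`, the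
steepest descent rate suffices for CG (`CGInvariant.energy_step`) and no Chebyshev argument is
needed. The preconditioned energy error equals the `K`-energy error of the returned vector
(`pcg_energy_le`).

The initial error is controlled by centrality. Write `p = B v` and `K q = p`; then `Bᵀ q` is the
projection of `v` onto the row space of `B`, so the energy of `q` is at most `‖v‖²`, which is `O(n
μ)` in the neighbourhood (`centeringVector_sq_le`). The residual `B (Bᵀ e)` costs one further factor
`σ_max(B)`. Taking logarithms gives the iteration count, and everything holds for each `ω` where the
sketch is good. -/

namespace SketchPCG

/-! ### Euclidean norms and the largest singular value -/

section Norms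

theorem norm2_nonneg {k : ℕ} (v : Fin k → ℝ) : 0 ≤ norm2 v := norm_nonneg _

theorem norm2_sq {k : ℕ} (v : Fin k → ℝ) : norm2 v ^ 2 = v ⬝ᵥ v := by
  rw [norm2, EuclideanSpace.norm_sq_eq]
  simp [dotProduct, sq]

theorem dotProduct_le_norm2_mul_norm2 {k : ℕ} (u v : Fin k → ℝ) :
    |u ⬝ᵥ v| ≤ norm2 u * norm2 v := by
  have h := abs_real_inner_le_norm (WithLp.toLp 2 u : EuclideanSpace ℝ (Fin k)) (WithLp.toLp 2 v)
  simpa [norm2, EuclideanSpace.inner_eq_star_dotProduct, dotProduct_comm] using h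

open scoped Matrix.Norms.L2Operator in
theorem norm2_mulVec_le_specNorm {k l : ℕ} (M : Matrix (Fin k) (Fin l) ℝ) (v : Fin l → ℝ) :
    norm2 (M *ᵥ v) ≤ specNorm M * norm2 v := by
  simpa [norm2, specNorm] using Matrix.l2_opNorm_mulVec M (WithLp.toLp 2 v)

theorem abs_dotProduct_mulVec_le_specNorm {k : ℕ} (M : Matrix (Fin k) (Fin k) ℝ)
    (v : Fin k → ℝ) : |v ⬝ᵥ (M *ᵥ v)| ≤ specNorm M * (v ⬝ᵥ v) := by
  calc |v ⬝ᵥ (M *ᵥ v)| ≤ norm2 v * norm2 (M *ᵥ v) := dotProduct_le_norm2_mul_norm2 _ _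
    _ ≤ norm2 v * (specNorm M * norm2 v) :=
        mul_le_mul_of_nonneg_left (norm2_mulVec_le_specNorm M v) (norm2_nonneg v)
    _ = specNorm M * (v ⬝ᵥ v) := by rw [← norm2_sq]; ring

/-- The largest singular value bounds the expansion of a linear map. -/
theorem _root_.LinearMap.norm_apply_le_singularValues_zero_mul {E F : Type*}
    [NormedAddCommGroup E] [InnerProductSpace ℝ E] [FiniteDimensional ℝ E]
    [NormedAddCommGroup F] [InnerProductSpace ℝ F] [FiniteDimensional ℝ F]
    (T : E →ₗ[ℝ] F) (v : E) : ‖T v‖ ≤ T.singularValues 0 * ‖v‖ := by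
  refine le_of_sq_le_sq ?_ (mul_nonneg (T.singularValues_nonneg 0) (norm_nonneg v))
  -- In an eigenbasis of `T* T` the form `‖T v‖²` is diagonal with entries `σ_i² ≤ σ_0²`.
  let b := T.isSymmetric_adjoint_comp_self.eigenvectorBasis rfl
  have hT : ‖T v‖ ^ 2 = inner ℝ v ((LinearMap.adjoint T ∘ₗ T) v) := by
    rw [LinearMap.comp_apply, LinearMap.adjoint_inner_right, real_inner_self_eq_norm_sq]
  have hv : ‖v‖ ^ 2 = ∑ i, inner ℝ v (b i) * inner ℝ (b i) v := by
    rw [b.sum_inner_mul_inner, real_inner_self_eq_norm_sq]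
  rw [hT, ← b.sum_inner_mul_inner, mul_pow, hv, Finset.mul_sum]
  refine Finset.sum_le_sum fun i _ => ?_
  have hi : inner ℝ (b i) ((LinearMap.adjoint T ∘ₗ T) v)
      = T.singularValues i ^ 2 * inner ℝ (b i) v := by
    rw [← T.isSymmetric_adjoint_comp_self, T.isSymmetric_adjoint_comp_self.apply_eigenvectorBasis,
      T.sq_singularValues_fin rfl, real_inner_smul_left]
    simp [b]
  have hsq : T.singularValues i ^ 2 ≤ T.singularValues 0 ^ 2 :=
    pow_le_pow_left₀ (T.singularValues_nonneg _) (T.singularValues_antitone (Nat.zero_le _)) 2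
  rw [hi, real_inner_comm v (b i)]
  nlinarith [mul_le_mul_of_nonneg_right hsq (mul_self_nonneg (inner ℝ v (b i)))]

theorem sigmaMax_nonneg {k l : ℕ} (M : Matrix (Fin k) (Fin l) ℝ) : 0 ≤ sigmaMax M :=
  LinearMap.singularValues_nonneg _ _

theorem norm2_mulVec_le_sigmaMax {k l : ℕ} (M : Matrix (Fin k) (Fin l) ℝ) (v : Fin l → ℝ) :
    norm2 (M *ᵥ v) ≤ sigmaMax M * norm2 v := by
  simpa [norm2, sigmaMax] using
    (Matrix.toEuclideanLin M).norm_apply_le_singularValues_zero_mul (WithLp.toLp 2 v)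

end Norms

/-! ### Linear convergence of conjugate gradients -/

section ConjugateGradients

variable {k : ℕ} {H : Matrix (Fin k) (Fin k) ℝ}

theorem dotProduct_mulVec_comm (hH : Hᵀ = H) (u v : Fin k → ℝ) :
    u ⬝ᵥ (H *ᵥ v) = v ⬝ᵥ (H *ᵥ u) := by
  rw [Matrix.dotProduct_mulVec, ← Matrix.mulVec_transpose, hH, dotProduct_comm]

theorem dotProduct_self_nonneg (v : Fin k → ℝ) : 0 ≤ v ⬝ᵥ v := by
  rw [← norm2_sq]; positivity

theorem eq_zero_of_energy_eq_zero {lo : ℝ} (hlo : 0 < lo)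
    (hHlo : ∀ v, lo * (v ⬝ᵥ v) ≤ v ⬝ᵥ (H *ᵥ v)) {v : Fin k → ℝ}
    (hv : v ⬝ᵥ (H *ᵥ v) = 0) : v = 0 :=
  dotProduct_self_eq_zero.1 <| le_antisymm
    (nonpos_of_mul_nonpos_right (hv ▸ hHlo v) hlo) (dotProduct_self_nonneg v)

/-- The relations between residual and search direction that CG maintains. -/
structure CGInvariant (H : Matrix (Fin k) (Fin k) ℝ) (b : Fin k → ℝ) (S : CGState k) : Prop where
  residual : S.r = b - H *ᵥ S.z
  dir_residual : S.r ⬝ᵥ S.d = S.r ⬝ᵥ S.r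
  conjugate : S.d ⬝ᵥ (H *ᵥ S.d) = S.d ⬝ᵥ (H *ᵥ S.r)

variable {b : Fin k → ℝ} {S : CGState k}

theorem CGInvariant.eq_zero_of_dir (h : CGInvariant H b S)
    (hpos : ∀ v, v ⬝ᵥ (H *ᵥ v) = 0 → v = 0) (hd : S.d ⬝ᵥ (H *ᵥ S.d) = 0) : S.r = 0 := by
  have h0 := hpos _ hd
  have := h.dir_residual
  rw [h0, dotProduct_zero] at this
  exact dotProduct_self_eq_zero.1 this.symm

/-- Only local relations are propagated: the new residual is orthogonal to the old residual and
direction, which makes `β` the coefficient for conjugate consecutive directions. Full Krylov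
orthogonality is not needed. -/
theorem CGInvariant.step (hH : Hᵀ = H) (hpos : ∀ v, v ⬝ᵥ (H *ᵥ v) = 0 → v = 0)
    (h : CGInvariant H b S) : CGInvariant H b (cgStep H S) := by
  -- After convergence `α` and `β` are both `0`, as division by zero gives zero.
  by_cases hr : S.r = 0
  · constructor
    · simp [cgStep, hr, ← h.residual]
    · simp [cgStep, hr]
    · simp [cgStep, hr]
  have hrr : S.r ⬝ᵥ S.r ≠ 0 := fun h0 => hr (dotProduct_self_eq_zero.1 h0)
  have hdd : S.d ⬝ᵥ (H *ᵥ S.d) ≠ 0 := fun h0 => hr (h.eq_zero_of_dir hpos h0)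
  obtain ⟨hres, hdr, hcon⟩ := h
  set α : ℝ := (S.r ⬝ᵥ S.r) / (S.d ⬝ᵥ (H *ᵥ S.d)) with hα
  set r' : Fin k → ℝ := S.r - α • (H *ᵥ S.d) with hr'
  set β : ℝ := (r' ⬝ᵥ r') / (S.r ⬝ᵥ S.r) with hβ
  have hstep : cgStep H S = ⟨S.z + α • S.d, r', r' + β • S.d⟩ := rfl
  have hαd : α * (S.d ⬝ᵥ (H *ᵥ S.d)) = S.r ⬝ᵥ S.r := div_mul_cancel₀ _ hdd
  have hα0 : α ≠ 0 := div_ne_zero hrr hdd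
  have hβr : β * (S.r ⬝ᵥ S.r) = r' ⬝ᵥ r' := div_mul_cancel₀ _ hrr
  have hr'd : r' ⬝ᵥ S.d = 0 := by
    rw [hr', sub_dotProduct, smul_dotProduct, smul_eq_mul, dotProduct_comm (H *ᵥ S.d), hαd, hdr,
      sub_self]
  have hr'r : r' ⬝ᵥ S.r = 0 := by
    rw [hr', sub_dotProduct, smul_dotProduct, smul_eq_mul, dotProduct_comm (H *ᵥ S.d),
      dotProduct_mulVec_comm hH, ← hcon, hαd, sub_self]
  have hr'H : r' ⬝ᵥ (H *ᵥ S.d) = -(β * (S.d ⬝ᵥ (H *ᵥ S.d))) := by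
    -- Substitute `α H d = r - r'` and use `r' ⟂ r`.
    have h1 : α * (r' ⬝ᵥ (H *ᵥ S.d)) = - (r' ⬝ᵥ r') := by
      have : r' ⬝ᵥ r' = r' ⬝ᵥ S.r - α * (r' ⬝ᵥ (H *ᵥ S.d)) := by
        conv_lhs => rw [hr', ← hr', dotProduct_sub, dotProduct_smul, smul_eq_mul]
      rw [this, hr'r]; ring
    apply mul_left_cancel₀ hα0
    rw [h1, ← hβr, ← hαd]; ring
  rw [hstep]
  refine ⟨?_, ?_, ?_⟩
  · simp only [Matrix.mulVec_add, Matrix.mulVec_smul, hr', hres]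
    abel
  · simp only [dotProduct_add, dotProduct_smul, hr'd, smul_zero, add_zero]
  · simp only [Matrix.mulVec_add, Matrix.mulVec_smul, dotProduct_add, dotProduct_smul,
      add_dotProduct, smul_dotProduct, hr'H, smul_eq_mul]
    ring

theorem cgInvariant_iterate (hH : Hᵀ = H) (hpos : ∀ v, v ⬝ᵥ (H *ᵥ v) = 0 → v = 0)
    (b : Fin k → ℝ) (t : ℕ) : CGInvariant H b ((cgStep H)^[t] { z := 0, r := b, d := b }) := by
  induction t with
  | zero => constructor <;> simp
  | succ t ih =>
    rw [Function.iterate_succ_apply']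
    exact ih.step hH hpos

/-- One CG step reduces the squared energy error at least as much as a steepest descent step
does. -/
theorem CGInvariant.energy_step (hH : Hᵀ = H) {lo hi : ℝ} (hlo : 0 < lo) (hhi : 0 < hi)
    (hHlo : ∀ v, lo * (v ⬝ᵥ v) ≤ v ⬝ᵥ (H *ᵥ v)) (hHhi : ∀ v, v ⬝ᵥ (H *ᵥ v) ≤ hi * (v ⬝ᵥ v))
    (h : CGInvariant H b S) {z : Fin k → ℝ} (hz : H *ᵥ z = b) :
    ((cgStep H S).z - z) ⬝ᵥ (H *ᵥ ((cgStep H S).z - z))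
      ≤ (1 - lo / hi) * ((S.z - z) ⬝ᵥ (H *ᵥ (S.z - z))) := by
  have hpos := fun v => eq_zero_of_energy_eq_zero hlo hHlo (v := v)
  set e := S.z - z with he
  have hHe : H *ᵥ e = -S.r := by rw [he, Matrix.mulVec_sub, hz, h.residual]; abel
  by_cases hr : S.r = 0
  · have he0 : e = 0 := hpos e (by rw [hHe, hr]; simp)
    have : (cgStep H S).z - z = 0 := by
      have : (cgStep H S).z = S.z := by simp [cgStep, hr]
      rw [this, ← he, he0]
    rw [this, he0]; simp
  have nn := dotProduct_self_nonneg (k := k)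
  have hrr : 0 < S.r ⬝ᵥ S.r :=
    lt_of_le_of_ne (nn _) fun h0 => hr (dotProduct_self_eq_zero.1 h0.symm)
  have hdd : 0 < S.d ⬝ᵥ (H *ᵥ S.d) :=
    lt_of_le_of_ne ((mul_nonneg hlo.le (nn _)).trans (hHlo _))
      fun h0 => hr (h.eq_zero_of_dir hpos h0.symm)
  -- The comparison with steepest descent: `r - d` is `H`-orthogonal to `d`, so Pythagoras applies.
  have hdle : S.d ⬝ᵥ (H *ᵥ S.d) ≤ S.r ⬝ᵥ (H *ᵥ S.r) := by
    have h1 : 0 ≤ (S.r - S.d) ⬝ᵥ (H *ᵥ (S.r - S.d)) :=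
      (mul_nonneg hlo.le (nn _)).trans (hHlo _)
    simp only [Matrix.mulVec_sub, dotProduct_sub, sub_dotProduct] at h1
    have h2 := h.conjugate
    have h3 := dotProduct_mulVec_comm hH S.r S.d
    linarith
  have hE : e ⬝ᵥ (H *ᵥ e) ≤ (S.r ⬝ᵥ S.r) / lo := by
    have h1 : e ⬝ᵥ (H *ᵥ e) ≤ norm2 e * norm2 S.r := by
      rw [hHe, dotProduct_neg]
      exact (neg_le_abs _).trans (dotProduct_le_norm2_mul_norm2 _ _)
    have h2 := hHlo e
    rw [← norm2_sq] at h2 ⊢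
    have h3 := norm2_nonneg e
    have h4 := norm2_nonneg S.r
    rw [le_div_iff₀ hlo]
    have h5 : lo * norm2 e ≤ norm2 S.r := by
      rcases h3.eq_or_lt with h0 | h0
      · rw [← h0]; simpa using h4
      · nlinarith
    nlinarith
  -- The exact decrease given by line search along `d`.
  have hEn : ((cgStep H S).z - z) ⬝ᵥ (H *ᵥ ((cgStep H S).z - z))
      = e ⬝ᵥ (H *ᵥ e) - (S.r ⬝ᵥ S.r) ^ 2 / (S.d ⬝ᵥ (H *ᵥ S.d)) := by
    have h1 : (cgStep H S).z - z = e + ((S.r ⬝ᵥ S.r) / (S.d ⬝ᵥ (H *ᵥ S.d))) • S.d := by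
      simp only [cgStep, he]; abel
    have h2 : e ⬝ᵥ (H *ᵥ S.d) = -(S.r ⬝ᵥ S.r) := by
      rw [dotProduct_mulVec_comm hH, hHe, dotProduct_neg, dotProduct_comm, h.dir_residual]
    have h3 : S.d ⬝ᵥ (H *ᵥ e) = -(S.r ⬝ᵥ S.r) := by rw [← dotProduct_mulVec_comm hH, h2]
    rw [h1]
    simp only [Matrix.mulVec_add, Matrix.mulVec_smul, dotProduct_add, dotProduct_smul,
      add_dotProduct, smul_dotProduct, smul_eq_mul, h2, h3]
    field_simp
    ring
  have hdec : lo / hi * (e ⬝ᵥ (H *ᵥ e)) ≤ (S.r ⬝ᵥ S.r) ^ 2 / (S.d ⬝ᵥ (H *ᵥ S.d)) := by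
    calc lo / hi * (e ⬝ᵥ (H *ᵥ e)) ≤ lo / hi * ((S.r ⬝ᵥ S.r) / lo) :=
          mul_le_mul_of_nonneg_left hE (by positivity)
      _ = (S.r ⬝ᵥ S.r) ^ 2 / (hi * (S.r ⬝ᵥ S.r)) := by field_simp
      _ ≤ (S.r ⬝ᵥ S.r) ^ 2 / (S.d ⬝ᵥ (H *ᵥ S.d)) :=
          div_le_div_of_nonneg_left (by positivity) hdd (hdle.trans (hHhi _))
  rw [hEn]
  linarith

theorem cgIterate_energy_le (hH : Hᵀ = H) {lo hi : ℝ} (hlo : 0 < lo) (hhi : lo ≤ hi)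
    (hHlo : ∀ v, lo * (v ⬝ᵥ v) ≤ v ⬝ᵥ (H *ᵥ v)) (hHhi : ∀ v, v ⬝ᵥ (H *ᵥ v) ≤ hi * (v ⬝ᵥ v))
    {z : Fin k → ℝ} (hz : H *ᵥ z = b) (t : ℕ) :
    (cgIterate H b t - z) ⬝ᵥ (H *ᵥ (cgIterate H b t - z))
      ≤ (1 - lo / hi) ^ t * (z ⬝ᵥ (H *ᵥ z)) := by
  have hpos := fun v => eq_zero_of_energy_eq_zero hlo hHlo (v := v)
  have hhi0 : 0 < hi := hlo.trans_le hhi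
  induction t with
  | zero => simp [cgIterate, Matrix.mulVec_neg]
  | succ t ih =>
    have h := (cgInvariant_iterate hH hpos b t).energy_step hH hlo hhi0 hHlo hHhi hz
    rw [← Function.iterate_succ_apply' (cgStep H)] at h
    refine h.trans ?_
    rw [pow_succ', mul_assoc]
    exact mul_le_mul_of_nonneg_left ih (sub_nonneg.2 ((div_le_one hhi0).2 hhi))

end ConjugateGradients

/-! ### Preconditioning by the sketched Gram matrix -/

section Preconditioner

theorem dotProduct_gram_mulVec {m n : ℕ} (B : Matrix (Fin m) (Fin n) ℝ) (v : Fin m → ℝ) :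
    v ⬝ᵥ ((B * Bᵀ) *ᵥ v) = (Bᵀ *ᵥ v) ⬝ᵥ (Bᵀ *ᵥ v) := by
  rw [← Matrix.mulVec_mulVec, Matrix.dotProduct_mulVec, ← Matrix.mulVec_transpose]

theorem posDef_gram {m n : ℕ} {B : Matrix (Fin m) (Fin n) ℝ}
    (hB : ∀ v, Bᵀ *ᵥ v = 0 → v = 0) : (B * Bᵀ).PosDef := by
  refine Matrix.PosDef.of_dotProduct_mulVec_pos (isHermitian_gram B) fun v hv => ?_
  rw [star_trivial, dotProduct_gram_mulVec]
  exact (dotProduct_self_nonneg _).lt_of_ne fun h => hv (hB v (dotProduct_self_eq_zero.1 h.symm))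

theorem invSqrtGram_transpose {m w : ℕ} (M : Matrix (Fin m) (Fin w) ℝ) :
    (invSqrtGram M)ᵀ = invSqrtGram M := by
  simp only [invSqrtGram, Matrix.transpose_mul, Matrix.transpose_transpose,
    Matrix.diagonal_transpose, Matrix.mul_assoc]

theorem invSqrtGram_mul_gram_mul {m w : ℕ} {M : Matrix (Fin m) (Fin w) ℝ}
    (hM : (M * Mᵀ).PosDef) : invSqrtGram M * (M * Mᵀ) * invSqrtGram M = 1 := by
  set U : Matrix (Fin m) (Fin m) ℝ := ↑(isHermitian_gram M).eigenvectorUnitary with hU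
  have hUU : Uᵀ * U = 1 := by
    have := Unitary.coe_star_mul_self (isHermitian_gram M).eigenvectorUnitary
    simpa [Matrix.star_eq_conjTranspose] using this
  have hUU' : U * Uᵀ = 1 := mul_eq_one_comm.1 hUU
  set l := (isHermitian_gram M).eigenvalues with hl
  have hspec : M * Mᵀ = U * Matrix.diagonal l * Uᵀ := by
    have := (isHermitian_gram M).spectral_theorem
    rw [Unitary.conjStarAlgAut_apply] at this
    simpa [Matrix.star_eq_conjTranspose] using this
  have hR : invSqrtGram M = U * Matrix.diagonal (fun i => (Real.sqrt (l i))⁻¹) * Uᵀ := rfl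
  have hpos : ∀ i, 0 < l i := fun i => (isHermitian_gram M).posDef_iff_eigenvalues_pos.1 hM i
  rw [hR, hspec]
  calc _ = U * Matrix.diagonal (fun i => (Real.sqrt (l i))⁻¹) * (Uᵀ * U) * Matrix.diagonal l *
        (Uᵀ * U) * Matrix.diagonal (fun i => (Real.sqrt (l i))⁻¹) * Uᵀ := by
        simp only [Matrix.mul_assoc]
    _ = U * (Matrix.diagonal (fun i => (Real.sqrt (l i))⁻¹) * Matrix.diagonal l *
        Matrix.diagonal (fun i => (Real.sqrt (l i))⁻¹)) * Uᵀ := by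
        rw [hUU]; simp only [Matrix.mul_assoc, Matrix.one_mul]
    _ = 1 := by
        have : (fun i => (Real.sqrt (l i))⁻¹ * l i * (Real.sqrt (l i))⁻¹) = fun _ => (1 : ℝ) := by
          funext i
          have h := Real.sqrt_pos.2 (hpos i)
          have h2 := Real.mul_self_sqrt (hpos i).le
          field_simp
          rw [sq, h2]
        rw [Matrix.diagonal_mul_diagonal, Matrix.diagonal_mul_diagonal, this, Matrix.diagonal_one,
          Matrix.mul_one, hUU']

/-- If `B W (B W)ᵀ` approximates `B Bᵀ` spectrally up to a factor `1 ± ε`, then preconditioned CG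
contracts the squared energy error by `1 - (1 - ε) / (1 + ε)` per step. -/
theorem pcg_energy_le {m n w : ℕ} {B : Matrix (Fin m) (Fin n) ℝ}
    (hB : ∀ v, Bᵀ *ᵥ v = 0 → v = 0) (W : Matrix (Fin n) (Fin w) ℝ) {ε : ℝ} (hε₀ : 0 ≤ ε)
    (hε₁ : ε < 1)
    (hlo : ∀ v, (1 - ε) * (v ⬝ᵥ ((B * Bᵀ) *ᵥ v)) ≤ v ⬝ᵥ ((B * W * (B * W)ᵀ) *ᵥ v))
    (hhi : ∀ v, v ⬝ᵥ ((B * W * (B * W)ᵀ) *ᵥ v) ≤ (1 + ε) * (v ⬝ᵥ ((B * Bᵀ) *ᵥ v)))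
    (p q : Fin m → ℝ) (hq : (B * Bᵀ) *ᵥ q = p) (t : ℕ) :
    (pcg B p W t - q) ⬝ᵥ ((B * Bᵀ) *ᵥ (pcg B p W t - q))
      ≤ (1 - (1 - ε) / (1 + ε)) ^ t * (q ⬝ᵥ ((B * Bᵀ) *ᵥ q)) := by
  have hKpos := posDef_gram hB
  have hQpos : (B * W * (B * W)ᵀ).PosDef := by
    refine Matrix.PosDef.of_dotProduct_mulVec_pos (isHermitian_gram _) fun v hv => ?_
    have h := hKpos.dotProduct_mulVec_pos hv
    rw [star_trivial] at h ⊢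
    exact (mul_pos (by linarith) h).trans_le (hlo v)
  set K := B * Bᵀ with hK
  have hKT : Kᵀ = K := by simp [hK]
  set Q := B * W * (B * W)ᵀ with hQ
  set R := invSqrtGram (B * W) with hR
  have hRT : Rᵀ = R := invSqrtGram_transpose _
  have hRQR : R * Q * R = 1 := invSqrtGram_mul_gram_mul hQpos
  have hRinv : R * (Q * R) = 1 := by rw [← Matrix.mul_assoc, hRQR]
  have conj : ∀ (N : Matrix (Fin m) (Fin m) ℝ) (v : Fin m → ℝ),
      v ⬝ᵥ ((R * N * R) *ᵥ v) = (R *ᵥ v) ⬝ᵥ (N *ᵥ (R *ᵥ v)) := fun N v => by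
    rw [Matrix.mul_assoc, ← Matrix.mulVec_mulVec, ← Matrix.mulVec_mulVec, Matrix.dotProduct_mulVec,
      ← Matrix.mulVec_transpose, hRT]
  have hid : ∀ v, (R *ᵥ v) ⬝ᵥ (Q *ᵥ (R *ᵥ v)) = v ⬝ᵥ v := fun v => by
    rw [← conj, hRQR, Matrix.one_mulVec]
  -- `R Q R = 1` makes `Q R` the inverse of `R`, so `z` is the exact preconditioned solution.
  set z := (Q * R) *ᵥ q with hz
  have hRz : R *ᵥ z = q := by rw [hz, Matrix.mulVec_mulVec, hRinv, Matrix.one_mulVec]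
  have hsol : (R * K * R) *ᵥ z = R *ᵥ p := by
    rw [← Matrix.mulVec_mulVec, hRz, ← Matrix.mulVec_mulVec, hq]
  have h1 : 0 < 1 - ε := by linarith
  have h2 : 0 < 1 + ε := by linarith
  -- With `u = R v` one has `vᵀ v = uᵀ Q u`, so comparing `Q` with `K` at `u` bounds the spectrum of
  -- `R K R`.
  have key := cgIterate_energy_le (H := R * K * R) (lo := (1 + ε)⁻¹) (hi := (1 - ε)⁻¹)
    (by simp [Matrix.transpose_mul, hRT, hKT, Matrix.mul_assoc]) (inv_pos.2 h2)
    (inv_anti₀ h1 (by linarith))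
    (fun v => by
      rw [conj, inv_mul_le_iff₀ h2, ← hid v]; exact hhi _)
    (fun v => by
      rw [conj, le_inv_mul_iff₀ h1, ← hid v]; exact hlo _)
    hsol t
  have hrate : (1 + ε)⁻¹ / (1 - ε)⁻¹ = (1 - ε) / (1 + ε) := by field_simp
  rw [conj, conj, Matrix.mulVec_sub, hRz, hrate] at key
  exact key

end Preconditioner

/-! ### Normal equations and the size of the right-hand side -/

section NormalEquations

/-- A thin SVD turns an approximate isometry on the row space of `B` into a spectral approximation
of `B Bᵀ`. -/
theorem IsThinSVD.abs_sketch_sub_le {m n w : ℕ} {B : Matrix (Fin m) (Fin n) ℝ}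
    {U : Matrix (Fin m) (Fin m) ℝ} {d : Fin m → ℝ} {V : Matrix (Fin m) (Fin n) ℝ}
    (h : IsThinSVD B U d V) (W : Matrix (Fin n) (Fin w) ℝ) {ε : ℝ}
    (hW : specNorm (V * W * Wᵀ * Vᵀ - 1) ≤ ε) (v : Fin m → ℝ) :
    |v ⬝ᵥ ((B * W * (B * W)ᵀ) *ᵥ v) - v ⬝ᵥ ((B * Bᵀ) *ᵥ v)| ≤ ε * (v ⬝ᵥ ((B * Bᵀ) *ᵥ v)) := by
  set N := U * Matrix.diagonal d with hN
  have hB : B = N * V := h.eq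
  have hK : B * Bᵀ = N * 1 * Nᵀ := by
    rw [hB, Matrix.transpose_mul, Matrix.mul_one]
    calc N * V * (Vᵀ * Nᵀ) = N * (V * Vᵀ) * Nᵀ := by simp only [Matrix.mul_assoc]
      _ = _ := by rw [h.right_orthonormal, Matrix.mul_one]
  have hQ : B * W * (B * W)ᵀ = N * (V * W * Wᵀ * Vᵀ) * Nᵀ := by
    rw [hB]; simp only [Matrix.transpose_mul, Matrix.mul_assoc]
  have conj : ∀ G : Matrix (Fin m) (Fin m) ℝ,
      v ⬝ᵥ ((N * G * Nᵀ) *ᵥ v) = (Nᵀ *ᵥ v) ⬝ᵥ (G *ᵥ (Nᵀ *ᵥ v)) := fun G => by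
    clear_value N
    rw [Matrix.mul_assoc, ← Matrix.mulVec_mulVec, ← Matrix.mulVec_mulVec, Matrix.dotProduct_mulVec,
      ← Matrix.mulVec_transpose]
  rw [hK, hQ, conj, conj, ← dotProduct_sub, ← Matrix.sub_mulVec, Matrix.one_mulVec]
  exact (abs_dotProduct_mulVec_le_specNorm _ _).trans
    (mul_le_mul_of_nonneg_right hW (dotProduct_self_nonneg _))

/-- The least-norm solution of `B u = B v` is no longer than `v`. -/
theorem energy_gram_solution_le {m n : ℕ} (B : Matrix (Fin m) (Fin n) ℝ) {q : Fin m → ℝ}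
    {v : Fin n → ℝ} (hq : (B * Bᵀ) *ᵥ q = B *ᵥ v) : q ⬝ᵥ ((B * Bᵀ) *ᵥ q) ≤ v ⬝ᵥ v := by
  have h1 := dotProduct_gram_mulVec B q
  have h2 : q ⬝ᵥ ((B * Bᵀ) *ᵥ q) = (Bᵀ *ᵥ q) ⬝ᵥ v := by
    rw [hq, Matrix.dotProduct_mulVec, ← Matrix.mulVec_transpose]
  have h3 := dotProduct_self_nonneg (v - Bᵀ *ᵥ q)
  simp only [dotProduct_sub, sub_dotProduct] at h3
  have h4 := dotProduct_comm v (Bᵀ *ᵥ q)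
  linarith

theorem normalMatrix_eq_gram {m n : ℕ} (A : Matrix (Fin m) (Fin n) ℝ) (x s : Fin n → ℝ) :
    normalMatrix A x s = A * scaling x s * (A * scaling x s)ᵀ := by
  rw [normalMatrix, Matrix.transpose_mul, sq]
  simp only [scaling, Matrix.diagonal_transpose, Matrix.mul_assoc]

theorem transpose_mulVec_eq_zero_of_rank {m n : ℕ} {A : Matrix (Fin m) (Fin n) ℝ}
    (hA : A.rank = m) {x s : Fin n → ℝ} (hx : ∀ i, 0 < x i) (hs : ∀ i, 0 < s i)
    {v : Fin m → ℝ} (hv : (A * scaling x s)ᵀ *ᵥ v = 0) : v = 0 := by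
  have h0 : Aᵀ *ᵥ v = 0 := by
    rw [Matrix.transpose_mul, ← Matrix.mulVec_mulVec] at hv
    funext i
    have := congrFun hv i
    simp only [scaling, Matrix.diagonal_transpose, Matrix.mulVec_diagonal, Pi.zero_apply] at this
    exact (mul_eq_zero.1 this).resolve_left (Real.sqrt_pos.2 (div_pos (hx i) (hs i))).ne'
  have hli : LinearIndependent ℝ A.row := by
    rw [linearIndependent_iff_card_eq_finrank_span, Set.finrank, ← A.rank_eq_finrank_span_row, hA,
      Fintype.card_fin]
  have hinj := Matrix.vecMul_injective_iff.2 hli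
  apply hinj
  simp only [Matrix.zero_vecMul]
  rw [← Matrix.mulVec_transpose, h0]

/-- The vector `v = (X S)^{-1/2} (x ∘ s - σ μ 1)`, for which `p = A D v`. -/
noncomputable def centeringVector {n : ℕ} (x s : Fin n → ℝ) (σ : ℝ) : Fin n → ℝ :=
  fun i => (x i * s i - σ * dualityMeasure x s) / Real.sqrt (x i * s i)

theorem normalRhs_eq {m n : ℕ} (A : Matrix (Fin m) (Fin n) ℝ) {x s : Fin n → ℝ}
    (hx : ∀ i, 0 < x i) (hs : ∀ i, 0 < s i) (σ : ℝ) :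
    normalRhs A x s σ = (A * scaling x s) *ᵥ centeringVector x s σ := by
  rw [normalRhs, ← Matrix.mulVec_mulVec, ← Matrix.mulVec_smul, ← Matrix.mulVec_neg,
    ← Matrix.mulVec_add]
  congr 1
  funext i
  have h1 := Real.sqrt_pos.2 (hx i)
  have h2 := Real.sqrt_pos.2 (hs i)
  have h3 := Real.mul_self_sqrt (hs i).le
  have h4 := (hs i).ne'
  simp only [scaling, Matrix.mulVec_diagonal, centeringVector, Pi.add_apply, Pi.neg_apply,
    Pi.smul_apply, smul_eq_mul, Real.sqrt_div (hx i).le, Real.sqrt_mul (hx i).le]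
  field_simp
  rw [sq, h3]
  ring

/-- Each squared entry is at most `x_i s_i + μ² / (x_i s_i)`, and centrality gives `x_i s_i ≥ (1 -
θ) μ`; sum over `i`. -/
theorem centeringVector_sq_le {n m : ℕ} {θ : ℝ} (hθ : θ < 1) {x s : Fin n → ℝ} {y : Fin m → ℝ}
    (h : (x, y, s) ∈ N2 n m θ) {σ : ℝ} (hσ₀ : 0 ≤ σ) (hσ₁ : σ ≤ 1) :
    centeringVector x s σ ⬝ᵥ centeringVector x s σ
      ≤ (1 + (1 - θ)⁻¹) * (n * dualityMeasure x s) := by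
  obtain ⟨hN, hx, hs⟩ := h
  simp only at hN hx hs
  rcases Nat.eq_zero_or_pos n with rfl | hn
  · simp [dotProduct]
  set μ := dualityMeasure x s with hμ
  have hn' : (0 : ℝ) < n := by exact_mod_cast hn
  have hsum : ∑ i, x i * s i = n * μ := by
    rw [hμ, dualityMeasure, mul_div_cancel₀ _ hn'.ne']; rfl
  have : Nonempty (Fin n) := ⟨⟨0, hn⟩⟩
  have hμ0 : 0 < μ := by
    have : 0 < ∑ i, x i * s i :=
      Finset.sum_pos (fun i _ => mul_pos (hx i) (hs i)) Finset.univ_nonempty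
    rw [hsum] at this
    exact (mul_pos_iff_of_pos_left hn').1 this
  have h1θ : 0 < 1 - θ := by linarith
  have hlow : ∀ i, (1 - θ) * μ ≤ x i * s i := fun i => by
    have h1 : |x i * s i - μ| ≤ norm2 (fun i => x i * s i - μ) := by
      simpa [norm2] using PiLp.norm_apply_le
        (WithLp.toLp 2 (fun i => x i * s i - μ) : EuclideanSpace ℝ (Fin n)) i
    have h2 := (abs_le.1 (h1.trans hN)).1
    linarith
  have hterm : ∀ i, centeringVector x s σ i * centeringVector x s σ i
      ≤ x i * s i + (1 - θ)⁻¹ * μ := fun i => by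
    have hp := mul_pos (hx i) (hs i)
    have h1 : centeringVector x s σ i * centeringVector x s σ i
        = (x i * s i - σ * μ) ^ 2 / (x i * s i) := by
      rw [centeringVector, div_mul_div_comm, Real.mul_self_sqrt hp.le, sq]
    rw [h1, div_le_iff₀ hp]
    have h2 : μ ≤ (1 - θ)⁻¹ * (x i * s i) := by
      rw [← div_eq_inv_mul, le_div_iff₀ h1θ, mul_comm]; exact hlow i
    have h3 : (σ * μ) ^ 2 ≤ μ * μ := by
      have : σ * μ ≤ μ := by nlinarith
      have : 0 ≤ σ * μ := by positivity
      nlinarith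
    have h4 : 0 ≤ x i * s i * (σ * μ) := by positivity
    nlinarith [mul_le_mul_of_nonneg_left h2 hμ0.le]
  calc centeringVector x s σ ⬝ᵥ centeringVector x s σ
      ≤ ∑ i, (x i * s i + (1 - θ)⁻¹ * μ) := Finset.sum_le_sum fun i _ => hterm i
    _ = (1 + (1 - θ)⁻¹) * (n * μ) := by
        rw [Finset.sum_add_distrib, hsum]; simp; ring

end NormalEquations

/-! ### Iteration count and the solver guarantee -/

/-- Enough iterations of a linearly convergent method reduce the error `c r` below `1`. -/
theorem pow_mul_mul_le_one {ρ c r : ℝ} (hρ₀ : 0 < ρ) (hρ₁ : ρ < 1) (hc : 0 < c) (hr : 0 ≤ r)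
    {t : ℕ} (ht : (1 + Real.posLog c) / -Real.log ρ * (1 + Real.posLog r) ≤ t) :
    ρ ^ t * (c * r) ≤ 1 := by
  rcases hr.eq_or_lt with rfl | hr
  · simp
  have hL : 0 < -Real.log ρ := neg_pos.2 (Real.log_neg hρ₀ hρ₁)
  rw [div_mul_eq_mul_div, div_le_iff₀ hL] at ht
  have h1 : Real.log c ≤ Real.posLog c := le_max_right _ _
  have h2 : Real.log r ≤ Real.posLog r := le_max_right _ _
  -- Expanding, `(1 + log⁺ c)(1 + log⁺ r) ≥ log c + log r`.
  have h3 := mul_nonneg (Real.posLog_nonneg (x := c)) (Real.posLog_nonneg (x := r))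
  rw [← Real.log_nonpos_iff (by positivity), Real.log_mul (by positivity) (by positivity),
    Real.log_mul hc.ne' hr.ne', Real.log_pow]
  linarith

/-- The deterministic core, for one realization of the sketch. The rate carries a square root
because the contraction is for the squared energy; `max 1 σ_max` serves both error measures at once.
-/
theorem solveGuarantee_pcg {θ ζ : ℝ} (hθ : θ < 1) (hζ₀ : 0 < ζ) (hζ₁ : ζ < 1) {m n w : ℕ}
    {A : Matrix (Fin m) (Fin n) ℝ} (hA : A.rank = m) {x s : Fin n → ℝ} {y : Fin m → ℝ}
    (hN : (x, y, s) ∈ N2 n m θ) {σ δ : ℝ} (hσ₀ : 0 ≤ σ) (hσ₁ : σ ≤ 1) (hδ : 0 < δ)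
    {U : Matrix (Fin m) (Fin m) ℝ} {d : Fin m → ℝ} {V : Matrix (Fin m) (Fin n) ℝ}
    (hU : IsThinSVD (A * scaling x s) U d V) {W : Matrix (Fin n) (Fin w) ℝ}
    (hW : specNorm (V * W * Wᵀ * Vᵀ - 1) ≤ ζ / 2) {t : ℕ}
    (ht : Real.sqrt (1 - (1 - ζ / 2) / (1 + ζ / 2)) ^ t * (Real.sqrt (1 + (1 - θ)⁻¹) *
      (max 1 (sigmaMax (A * scaling x s)) * Real.sqrt (n * dualityMeasure x s) / δ)) ≤ 1) :
    SolveGuarantee (normalMatrix A x s) (normalRhs A x s σ) δ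
      (pcg (A * scaling x s) (normalRhs A x s σ) W t) := by
  have hv := centeringVector_sq_le hθ hN hσ₀ hσ₁
  obtain ⟨-, hx, hs⟩ := hN
  simp only at hx hs
  have hp := normalRhs_eq A hx hs σ
  have hB : ∀ v, (A * scaling x s)ᵀ *ᵥ v = 0 → v = 0 := fun v =>
    transpose_mulVec_eq_zero_of_rank hA hx hs
  rw [normalMatrix_eq_gram]
  set B := A * scaling x s with hBdef
  set p := normalRhs A x s σ with hpdef
  set q := (B * Bᵀ)⁻¹ *ᵥ p with hqdef
  have hq : (B * Bᵀ) *ᵥ q = p := by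
    rw [hqdef, Matrix.mulVec_mulVec, Matrix.mul_nonsing_inv _
      ((Matrix.isUnit_iff_isUnit_det _).1 (posDef_gram hB).isUnit), Matrix.one_mulVec]
  have happ := hU.abs_sketch_sub_le W hW
  have hE := pcg_energy_le hB W (ε := ζ / 2) (by linarith) (by linarith)
    (fun v => by have := (abs_le.1 (happ v)).1; linarith)
    (fun v => by have := (abs_le.1 (happ v)).2; linarith) p q hq t
  have hρ : 0 ≤ 1 - (1 - ζ / 2) / (1 + ζ / 2) := by
    rw [sub_nonneg, div_le_one (by linarith)]; linarith
  have hE2 := hE.trans (mul_le_mul_of_nonneg_left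
    ((energy_gram_solution_le B (hq.trans hp)).trans hv) (pow_nonneg hρ t))
  set e := pcg B p W t - q with he
  set F := Real.sqrt (1 - (1 - ζ / 2) / (1 + ζ / 2)) ^ t * (Real.sqrt (1 + (1 - θ)⁻¹) *
    Real.sqrt (n * dualityMeasure x s)) with hF
  have hF0 : 0 ≤ F := by positivity
  have hen : energyNorm (B * Bᵀ) e ≤ F := by
    have hθ' : 0 < (1 - θ)⁻¹ := inv_pos.2 (by linarith)
    have hnμ : 0 ≤ n * dualityMeasure x s :=
      nonneg_of_mul_nonneg_right ((dotProduct_self_nonneg _).trans hv) (by linarith)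
    refine Real.sqrt_le_iff.2 ⟨hF0, hE2.trans_eq ?_⟩
    rw [hF, mul_pow, mul_pow, ← pow_mul, mul_comm t 2, pow_mul, Real.sq_sqrt hρ,
      Real.sq_sqrt (by linarith), Real.sq_sqrt hnμ]
  have hFδ : max 1 (sigmaMax B) * F ≤ δ := by
    have : Real.sqrt (1 - (1 - ζ / 2) / (1 + ζ / 2)) ^ t * (Real.sqrt (1 + (1 - θ)⁻¹) *
      (max 1 (sigmaMax B) * Real.sqrt (n * dualityMeasure x s) / δ))
        = max 1 (sigmaMax B) * F / δ := by rw [hF]; ring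
    rwa [this, div_le_one hδ] at ht
  refine ⟨hen.trans (le_trans ?_ hFδ), ?_⟩
  · exact le_mul_of_one_le_left hF0 (le_max_left _ _)
  -- The residual is `K e = B (Bᵀ e)`, and `‖Bᵀ e‖` is the energy norm of `e`.
  · have h1 : (B * Bᵀ) *ᵥ pcg B p W t - p = B *ᵥ (Bᵀ *ᵥ e) := by
      rw [Matrix.mulVec_mulVec, he, Matrix.mulVec_sub, hq]
    have h2 : norm2 (Bᵀ *ᵥ e) = energyNorm (B * Bᵀ) e := by
      rw [energyNorm, dotProduct_gram_mulVec, ← norm2_sq, Real.sqrt_sq (norm2_nonneg _)]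
    rw [h1]
    calc norm2 (B *ᵥ (Bᵀ *ᵥ e)) ≤ sigmaMax B * norm2 (Bᵀ *ᵥ e) := norm2_mulVec_le_sigmaMax _ _
      _ ≤ max 1 (sigmaMax B) * F := by
          rw [h2]
          exact mul_le_mul (le_max_right _ _) hen (Real.sqrt_nonneg _) (by positivity)
      _ ≤ δ := hFδ

end SketchPCG

theorem mainTheorem5 (θ ζ : ℝ) (hθ : θ < 1) (hζ₀ : 0 < ζ) (hζ₁ : ζ < 1) :
    ∃ C : ℝ, 0 < C ∧
      ∀ (m n w : ℕ) (A : Matrix (Fin m) (Fin n) ℝ), A.rank = m →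
      ∀ (x : Fin n → ℝ) (y : Fin m → ℝ) (s : Fin n → ℝ), (x, y, s) ∈ SketchPCG.N2 n m θ →
      ∀ σ δ η : ℝ, 0 ≤ σ → σ ≤ 1 → 0 < δ →
      -- a thin singular value decomposition of `A D`
      ∀ (U : Matrix (Fin m) (Fin m) ℝ) (d : Fin m → ℝ) (V : Matrix (Fin m) (Fin n) ℝ),
        SketchPCG.IsThinSVD (A * SketchPCG.scaling x s) U d V →
      -- a random sketching matrix `W`
      ∀ (Ω : Type*) [MeasurableSpace Ω] (P : Measure Ω) [IsProbabilityMeasure P]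
        (W : Ω → Matrix (Fin n) (Fin w) ℝ),
        (∀ i j, Measurable fun ω => W ω i j) →
        1 - η ≤ P.real {ω | SketchPCG.specNorm (V * W ω * (W ω)ᵀ * Vᵀ - 1) ≤ ζ / 2} →
      ∀ t : ℕ,
        (C * (1 + Real.posLog (max 1 (SketchPCG.sigmaMax (A * SketchPCG.scaling x s)) *
              Real.sqrt (n * SketchPCG.dualityMeasure x s) / δ)) ≤ t ∨
          (1 ≤ SketchPCG.sigmaMax (A * SketchPCG.scaling x s) ∧
            1 ≤ n * SketchPCG.dualityMeasure x s ∧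
            C * (1 + Real.posLog (SketchPCG.sigmaMax (A * SketchPCG.scaling x s) *
              (n * SketchPCG.dualityMeasure x s) / δ)) ≤ t)) →
        1 - η ≤ P.real {ω | SketchPCG.SolveGuarantee (SketchPCG.normalMatrix A x s)
          (SketchPCG.normalRhs A x s σ) δ
          (SketchPCG.pcg (A * SketchPCG.scaling x s) (SketchPCG.normalRhs A x s σ) (W ω) t)} := by
  have hρ₀ : 0 < 1 - (1 - ζ / 2) / (1 + ζ / 2) := by
    rw [sub_pos, div_lt_one (by linarith)]; linarith
  have hρ₁ : 1 - (1 - ζ / 2) / (1 + ζ / 2) < 1 := by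
    have : 0 < (1 - ζ / 2) / (1 + ζ / 2) := div_pos (by linarith) (by linarith)
    linarith
  have hρ₀' := Real.sqrt_pos.2 hρ₀
  have hρ₁' : Real.sqrt (1 - (1 - ζ / 2) / (1 + ζ / 2)) < 1 := by
    rw [Real.sqrt_lt' one_pos]; simpa using hρ₁
  have hc : 0 < Real.sqrt (1 + (1 - θ)⁻¹) := by
    have : 0 < (1 - θ)⁻¹ := inv_pos.2 (by linarith)
    positivity
  have hC : 0 < (1 + Real.posLog (Real.sqrt (1 + (1 - θ)⁻¹))) /
      -Real.log (Real.sqrt (1 - (1 - ζ / 2) / (1 + ζ / 2))) :=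
    div_pos (by linarith [Real.posLog_nonneg (x := Real.sqrt (1 + (1 - θ)⁻¹))])
      (neg_pos.2 (Real.log_neg hρ₀' hρ₁'))
  -- `C = (1 + log⁺ c) / (-log √ρ)`, with `c = √(1 + 1/(1 - θ))` and `ρ` the squared-energy rate.
  refine ⟨_, hC, ?_⟩
  intro m n w A hA x y s hN σ δ η hσ₀ hσ₁ hδ U d V hU Ω _ P _ W _ hW t ht
  -- The good-sketch event is contained in the success event; monotonicity needs no measurability of
  -- either.
  refine hW.trans (measureReal_mono fun ω hω => ?_)
  refine SketchPCG.solveGuarantee_pcg hθ hζ₀ hζ₁ hA hN hσ₀ hσ₁ hδ hU hω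
    (SketchPCG.pow_mul_mul_le_one hρ₀' hρ₁' hc (by positivity) ?_)
  rcases ht with ht | ⟨hσ, hnμ, ht⟩
  · exact ht
  -- The second threshold dominates the first, since `√(n μ) ≤ n μ` when `n μ ≥ 1`.
  · refine le_trans (mul_le_mul_of_nonneg_left (add_le_add_right
      (Real.posLog_le_posLog (by positivity) ?_) 1) hC.le) ht
    rw [max_eq_right hσ]
    have hsqrt : Real.sqrt (n * SketchPCG.dualityMeasure x s)
        ≤ n * SketchPCG.dualityMeasure x s := by
      rw [Real.sqrt_le_left (by linarith)]
      nlinarith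
    have := SketchPCG.sigmaMax_nonneg (A * SketchPCG.scaling x s)
    gcongr
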